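/- Let $\Gamma$ be the gamma function, let $\zeta(3)=\sum_{n\ge 1} n^{-3}$ be the value of the Riemann zeta function at $3$, and let $\mathrm{Cl}_2(\theta)=\sum_{k=1}^{\infty}\frac{\sin(k\theta)}{k^2}$ be Clausen's function. Then the double series of positive terms $$\sum_{n=1}^{\infty}\sum_{k=1}^{\infty}\frac{1}{k!}\,\frac{1}{n(n+k)}\,\frac{\Gamma(n+k)\,\Gamma(n+2k)}{\Gamma(2n+2k)}$$ converges (both as an iterated series, each inner series over $k$ being convergent, and as an unordered sum over all pairs $(n,k)$ of positive integers), and its sum is $$\frac{47}{12}\,\zeta(3)-\frac{4\pi}{3}\,\mathrm{Cl}_2\!\left(\frac{\pi}{3}\right).$$ -/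

import Mathlib

/-- Clausen's function `Cl₂(θ) = ∑_{k ≥ 1} sin (k θ) / k ^ 2`
(the series converges absolutely for every real `θ`). -/
noncomputable def clausenTwo (θ : ℝ) : ℝ :=
  ∑' k : ℕ+, Real.sin ((k : ℝ) * θ) / (k : ℝ) ^ 2

/-- The defining series of `clausenTwo` is summable for every real argument. -/
theorem summable_clausenTwo (θ : ℝ) :
    Summable (fun k : ℕ+ => Real.sin ((k : ℝ) * θ) / (k : ℝ) ^ 2) := by
  have h : Summable (fun k : ℕ => Real.sin ((k : ℝ) * θ) / (k : ℝ) ^ 2) := by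
    refine Summable.of_norm_bounded (Real.summable_one_div_nat_pow.mpr one_lt_two) fun k => ?_
    rw [norm_div, norm_pow, Real.norm_natCast, Real.norm_eq_abs]
    gcongr
    exact Real.abs_sin_le_one _
  exact h.comp_injective PNat.coe_injective

/-- The term `(1 / k!) * (1 / (n (n + k))) * Γ(n + k) Γ(n + 2 k) / Γ(2 n + 2 k)`. -/
noncomputable def gammaTerm (n k : ℕ+) : ℝ :=
  1 / (Nat.factorial (k : ℕ) : ℝ) * (1 / ((n : ℝ) * ((n : ℝ) + (k : ℝ)))) *
    (Real.Gamma ((n : ℝ) + (k : ℝ)) * Real.Gamma ((n : ℝ) + 2 * (k : ℝ)) /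
      Real.Gamma (2 * (n : ℝ) + 2 * (k : ℝ)))

/-!
Put `m = n + k`. The general term equals `(m choose n) / m ^ 2` times the Beta integral
`∫ t in 0..1, t ^ (2 m - n - 1) (1 - t) ^ (n - 1)`. By the binomial theorem for `(t + (1 - t)) ^ m`
the sum of the terms with given `m` is
`(H_{2m-1} - H_{m-1}) / m ^ 2 - 2 / (m ^ 3 (2m choose m))`, where `H` denotes harmonic numbers
(`sum_antidiagonal_gammaTerm`, in which the integrals are replaced by the finite identity
`sum_choose_mul_factorial_mul_factorial`). As all terms are nonnegative, it remains to sum two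
simple series over `m`.

* With `O_m = ∑_{i < m} 1 / (2 i + 1)` one has `H_{2m-1} - H_{m-1} = O_m - H_{m-1} / 2`.
  Summing the double series `∑ 1 / (m n (m + n))`, over all `m, n` and over even `m` and odd `n`,
  once by rows and once by antidiagonals, gives linear equations for `∑ H_{m-1} / m ^ 2` and
  `∑ O_m / m ^ 2`, whose solutions are `ζ(3)` and `7 / 4 ζ(3)`
  (`hasSum_harm_div_sq`, `hasSum_oddHarm_div_sq`).
* The function `∑ (2 sin θ) ^ (2 m) / (m ^ 3 (2m choose m))` has the derivative `4 θ ^ 2 cot θ`,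
  because `∑ (2 sin θ) ^ (2 m) / (m ^ 2 (2m choose m)) = 2 θ ^ 2`. Since
  `Cl₂' (x) = -log (2 sin (x / 2))` (`hasDerivAt_clausenTwo`), another antiderivative is
  `4 θ ^ 2 log (2 sin θ) + 4 θ Cl₂(2 θ) + 2 ∑ cos (2 m θ) / m ^ 3`. At `θ = π / 6` the logarithm
  vanishes, the last sum is `ζ(3) / 3`, and the result is
  `∑ 1 / (m ^ 3 (2m choose m)) = 2 π / 3 Cl₂(π / 3) - 4 / 3 ζ(3)`
  (`hasSum_one_div_cube_mul_centralBinom`).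
-/

open Finset.HasAntidiagonal (antidiagonal)
open scoped Topology

/-! ### Double series of nonnegative terms -/

/-- A nonnegative family on a sigma type has the same sum as the family of its fibre sums. -/
theorem hasSum_sigma_iff_of_nonneg {α : Type*} {β : α → Type*} {f : (Σ x, β x) → ℝ}
    (hf : ∀ x, 0 ≤ f x) {r : α → ℝ} (hr : ∀ x, HasSum (fun y => f ⟨x, y⟩) (r x)) {a : ℝ} :
    HasSum f a ↔ HasSum r a := by
  refine ⟨fun h => h.sigma hr, fun h => ?_⟩
  have hs : Summable f := by
    rw [summable_sigma_of_nonneg hf]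
    refine ⟨fun x => (hr x).summable, ?_⟩
    simpa only [(hr _).tsum_eq] using h.summable
  have := hs.hasSum.sigma hr
  rw [← this.unique h]
  exact hs.hasSum

theorem hasSum_prod_iff_of_nonneg {f : ℕ × ℕ → ℝ} (hf : ∀ p, 0 ≤ f p) {r : ℕ → ℝ}
    (hr : ∀ m, HasSum (fun n => f (m, n)) (r m)) {a : ℝ} :
    HasSum f a ↔ HasSum r a := by
  rw [← (Equiv.sigmaEquivProd ℕ ℕ).hasSum_iff]
  exact hasSum_sigma_iff_of_nonneg (fun x => hf _) hr

theorem hasSum_antidiagonal_iff_of_nonneg {f : ℕ × ℕ → ℝ} (hf : ∀ p, 0 ≤ f p) {a : ℝ} :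
    HasSum f a ↔ HasSum (fun s => ∑ p ∈ antidiagonal s, f p) a := by
  rw [← Finset.HasAntidiagonal.sigmaAntidiagonalEquivProd.hasSum_iff]
  refine hasSum_sigma_iff_of_nonneg (fun x => hf _) fun s => ?_
  exact Finset.hasSum (antidiagonal s) f

/-! ### Euler sums of weight three -/

/-- The harmonic number `H_n = ∑_{i < n} 1 / (i + 1)` as a real number. -/
noncomputable def harm (n : ℕ) : ℝ := ∑ i ∈ Finset.range n, 1 / ((i : ℝ) + 1)

/-- The odd harmonic number `O_n = ∑_{i < n} 1 / (2 i + 1)`. -/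
noncomputable def oddHarm (n : ℕ) : ℝ := ∑ i ∈ Finset.range n, 1 / (2 * (i : ℝ) + 1)

theorem harm_zero : harm 0 = 0 := by simp [harm]

theorem harm_succ (n : ℕ) : harm (n + 1) = harm n + 1 / ((n : ℝ) + 1) :=
  Finset.sum_range_succ _ _

theorem oddHarm_succ (n : ℕ) : oddHarm (n + 1) = oddHarm n + 1 / (2 * (n : ℝ) + 1) :=
  Finset.sum_range_succ _ _

theorem harm_nonneg (n : ℕ) : 0 ≤ harm n := Finset.sum_nonneg fun i _ => by positivity

/-- The odd and the even denominators up to `2 n + 1`. -/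
theorem harm_two_mul_add_one (n : ℕ) : harm (2 * n + 1) = oddHarm (n + 1) + harm n / 2 := by
  induction n with
  | zero => simp [harm, oddHarm]
  | succ n ih =>
    rw [show 2 * (n + 1) + 1 = 2 * n + 1 + 1 + 1 by ring, harm_succ, harm_succ, ih,
      oddHarm_succ (n + 1), harm_succ n]
    push_cast
    field_simp
    ring

theorem harm_le_two_mul_sqrt (n : ℕ) : harm n ≤ 2 * √(n : ℝ) := by
  induction n with
  | zero => simp [harm]
  | succ n ih =>
    rw [harm_succ]
    push_cast
    have h0 : (0 : ℝ) ≤ n := n.cast_nonneg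
    have ha := Real.sq_sqrt h0
    have hb := Real.sq_sqrt (show (0 : ℝ) ≤ n + 1 by positivity)
    have hab : √(n : ℝ) ≤ √((n : ℝ) + 1) := Real.sqrt_le_sqrt (by linarith)
    have hb1 : 1 ≤ √((n : ℝ) + 1) := Real.one_le_sqrt.2 (by linarith)
    have ha0 := Real.sqrt_nonneg (n : ℝ)
    set x := √(n : ℝ)
    set y := √((n : ℝ) + 1)
    have : 1 / ((n : ℝ) + 1) ≤ 2 * (y - x) := by
      rw [div_le_iff₀ (by positivity), ← hb]
      -- `(y - x) (y + x) = 1` and `y + x ≤ 2 y ≤ 2 y ^ 2`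
      have h1 : (y - x) * (y + x) = 1 := by nlinarith
      have h2 : y + x ≤ 2 * y ^ 2 := by nlinarith
      nlinarith [mul_le_mul_of_nonneg_left h2 (sub_nonneg.2 hab)]
    linarith

theorem summable_harm_div_sq : Summable fun n : ℕ => harm n / ((n : ℝ) + 1) ^ 2 := by
  have h : Summable fun n : ℕ => 2 * (1 / ((n + 1 : ℕ) : ℝ) ^ (3 / 2 : ℝ)) :=
    ((summable_nat_add_iff 1).2
      (Real.summable_one_div_nat_rpow.2 (by norm_num : (1 : ℝ) < 3 / 2))).mul_left 2
  refine h.of_nonneg_of_le (fun n => div_nonneg (harm_nonneg n) (by positivity)) fun n => ?_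
  have hn : (0 : ℝ) < (n : ℝ) + 1 := by positivity
  push_cast
  rw [div_le_iff₀ (by positivity)]
  have h1 : ((n : ℝ) + 1) ^ 2 = ((n : ℝ) + 1) ^ (3 / 2 : ℝ) * √((n : ℝ) + 1) := by
    rw [Real.sqrt_eq_rpow, ← Real.rpow_add hn, ← Real.rpow_natCast]
    norm_num
  rw [h1]
  have h2 : (0 : ℝ) < ((n : ℝ) + 1) ^ (3 / 2 : ℝ) := by positivity
  calc harm n ≤ 2 * √(n : ℝ) := harm_le_two_mul_sqrt n
    _ ≤ 2 * √((n : ℝ) + 1) := by gcongr; linarith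
    _ = _ := by field_simp

theorem hasSum_zeta_three :
    HasSum (fun n : ℕ => 1 / ((n : ℝ) + 1) ^ 3) (riemannZeta 3).re := by
  have hs : Summable fun n : ℕ => 1 / (n : ℝ) ^ 3 :=
    Real.summable_one_div_nat_pow.2 (by norm_num)
  have h := zeta_nat_eq_tsum_of_gt_one (k := 3) (by norm_num)
  have h2 : riemannZeta 3 = ((∑' n : ℕ, 1 / (n : ℝ) ^ 3 : ℝ) : ℂ) := by
    push_cast at h ⊢
    exact h
  have h3 := (hasSum_nat_add_iff' 1).2 hs.hasSum
  rw [h2, Complex.ofReal_re]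
  simpa using h3

/-- A telescoping series with gap `t`. -/
theorem hasSum_sub_shift {g : ℕ → ℝ} (hg : Filter.Tendsto g Filter.atTop (nhds 0))
    (hanti : Antitone g) (t : ℕ) :
    HasSum (fun i => g i - g (i + t)) (∑ i ∈ Finset.range t, g i) := by
  induction t with
  | zero => simp
  | succ t ih =>
    have h : HasSum (fun i => g (i + t) - g (i + 1 + t)) (g t) := by
      rw [hasSum_iff_tendsto_nat_of_nonneg
        (fun i => sub_nonneg.2 (hanti (by omega)))]
      simp only [Finset.sum_range_sub' (fun i => g (i + t))]
      have := (hg.comp (Filter.tendsto_add_atTop_nat t)).const_sub (g t)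
      simpa using this
    rw [Finset.sum_range_succ]
    refine (ih.add h).congr_fun fun i => ?_
    rw [show i + (t + 1) = i + 1 + t by ring]
    ring

theorem hasSum_harm (m : ℕ) :
    HasSum (fun n : ℕ => 1 / ((n : ℝ) + 1) - 1 / ((n : ℝ) + m + 1)) (harm m) := by
  have h := hasSum_sub_shift (g := fun n : ℕ => 1 / ((n : ℝ) + 1))
    tendsto_one_div_add_atTop_nhds_zero_nat ?_ m
  · simpa [harm] using h
  · intro a b hab
    have : (a : ℝ) ≤ b := by exact_mod_cast hab
    dsimp only
    gcongr

theorem hasSum_oddHarm (m : ℕ) :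
    HasSum (fun n : ℕ => 1 / (2 * (n : ℝ) + 1) - 1 / (2 * ((n : ℝ) + m) + 1)) (oddHarm m) := by
  have h := hasSum_sub_shift (g := fun n : ℕ => 1 / (2 * (n : ℝ) + 1)) ?_ ?_ m
  · simpa [oddHarm] using h
  · have := (tendsto_one_div_add_atTop_nhds_zero_nat (𝕜 := ℝ)).comp
      (Filter.tendsto_id.const_mul_atTop' (r := 2) (by norm_num))
    simpa [Function.comp_def] using this
  · intro a b hab
    have : (a : ℝ) ≤ b := by exact_mod_cast hab
    dsimp only
    gcongr

theorem sum_antidiagonal_fst_eq_harm (s : ℕ) :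
    ∑ p ∈ antidiagonal s, 1 / ((p.1 : ℝ) + 1) = harm (s + 1) :=
  Finset.Nat.sum_antidiagonal_eq_sum_range_succ (fun i _ => 1 / ((i : ℝ) + 1)) s

theorem sum_antidiagonal_snd_eq_harm (s : ℕ) :
    ∑ p ∈ antidiagonal s, 1 / ((p.2 : ℝ) + 1) = harm (s + 1) := by
  rw [← sum_antidiagonal_fst_eq_harm,
    ← Finset.Nat.sum_antidiagonal_swap (f := fun p => 1 / ((p.1 : ℝ) + 1))]
  rfl

/-- Euler's `∑ H_{n-1} / n ^ 2 = ζ(3)`. The double series `∑ 1 / (m n (m + n))`, summed by rows,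
is `∑ H_m / m ^ 2`; summed by antidiagonals it is `2 ∑ H_{s-1} / s ^ 2`. -/
theorem hasSum_harm_div_sq :
    HasSum (fun n : ℕ => harm n / ((n : ℝ) + 1) ^ 2) (riemannZeta 3).re := by
  obtain ⟨x, hx⟩ := summable_harm_div_sq
  let f : ℕ × ℕ → ℝ := fun p => 1 / (((p.1 : ℝ) + 1) * ((p.2 : ℝ) + 1) * (p.1 + p.2 + 2))
  have hf : ∀ p, 0 ≤ f p := fun p => by positivity
  have hrow : ∀ m, HasSum (fun n => f (m, n)) (harm (m + 1) / ((m : ℝ) + 1) ^ 2) := fun m => by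
    refine HasSum.congr_fun ((hasSum_harm (m + 1)).div_const (((m : ℝ) + 1) ^ 2)) fun n => ?_
    simp only [f]
    push_cast
    field_simp
    ring
  have hR : HasSum (fun m : ℕ => harm (m + 1) / ((m : ℝ) + 1) ^ 2) (x + (riemannZeta 3).re) := by
    refine HasSum.congr_fun (hx.add hasSum_zeta_three) fun m => ?_
    rw [harm_succ]
    field_simp
  have hanti : ∀ s, ∑ p ∈ antidiagonal s, f p
      = 2 * (harm (s + 1) / (((s + 1 : ℕ) : ℝ) + 1) ^ 2) := fun s => by
    calc _ = ∑ p ∈ antidiagonal s, (1 / ((p.1 : ℝ) + 1) + 1 / ((p.2 : ℝ) + 1))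
          / (((s + 1 : ℕ) : ℝ) + 1) ^ 2 := by
          refine Finset.sum_congr rfl fun p hp => ?_
          rw [← Finset.HasAntidiagonal.mem_antidiagonal.1 hp]
          simp only [f]
          push_cast
          field_simp
          ring
      _ = _ := by
          rw [← Finset.sum_div, Finset.sum_add_distrib, sum_antidiagonal_fst_eq_harm,
            sum_antidiagonal_snd_eq_harm]
          ring
  have hA := (hasSum_antidiagonal_iff_of_nonneg hf).1 ((hasSum_prod_iff_of_nonneg hf hrow).2 hR)
  simp only [hanti] at hA
  have hx' := ((hasSum_nat_add_iff' 1).2 hx).mul_left 2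
  have := hA.unique hx'
  simp [harm_zero] at this
  rwa [show (riemannZeta 3).re = x by linarith]

theorem harm_two_mul_succ (n : ℕ) : harm (2 * (n + 1)) = oddHarm (n + 1) + harm (n + 1) / 2 := by
  rw [show 2 * (n + 1) = 2 * n + 1 + 1 by ring, harm_succ, harm_two_mul_add_one, harm_succ]
  push_cast
  field_simp
  ring

theorem harm_two_mul_add_one_div_sq (n : ℕ) :
    harm (2 * n + 1) / (((2 * n + 1 : ℕ) : ℝ) + 1) ^ 2
      = oddHarm (n + 1) / ((n : ℝ) + 1) ^ 2 / 4 + harm n / ((n : ℝ) + 1) ^ 2 / 8 := by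
  rw [harm_two_mul_add_one]
  push_cast
  field_simp
  ring

theorem summable_oddHarm_div_sq :
    Summable fun n : ℕ => oddHarm (n + 1) / ((n : ℝ) + 1) ^ 2 := by
  have h1 : Summable fun n : ℕ => harm (2 * n + 1) / (((2 * n + 1 : ℕ) : ℝ) + 1) ^ 2 :=
    summable_harm_div_sq.comp_injective (i := fun n : ℕ => 2 * n + 1)
      fun a b h => by simpa using h
  refine ((h1.sub (summable_harm_div_sq.div_const 8)).mul_left 4).congr fun n => ?_
  rw [harm_two_mul_add_one_div_sq]
  ring

/-- The double series `∑ 1 / (m n (m + n))` over even `m` and odd `n`, summed by rows and by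
antidiagonals. -/
theorem hasSum_harm_two_mul_succ_div_sq {y : ℝ}
    (hy : HasSum (fun n : ℕ => oddHarm (n + 1) / ((n : ℝ) + 1) ^ 2) y) :
    HasSum (fun n : ℕ => harm (2 * (n + 1)) / (((2 * (n + 1) : ℕ) : ℝ) + 1) ^ 2) (y / 4) := by
  let f : ℕ × ℕ → ℝ := fun p =>
    1 / ((2 * (p.1 : ℝ) + 2) * (2 * (p.2 : ℝ) + 1) * (2 * p.1 + 2 * p.2 + 3))
  have hf : ∀ p, 0 ≤ f p := fun p => by positivity
  have hrow : ∀ m, HasSum (fun n => f (m, n)) (oddHarm (m + 1) / ((m : ℝ) + 1) ^ 2 / 4) :=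
    fun m => by
    refine HasSum.congr_fun
      (((hasSum_oddHarm (m + 1)).div_const (((m : ℝ) + 1) ^ 2)).div_const 4) fun n => ?_
    simp only [f]
    push_cast
    field_simp
    ring
  have hA := (hasSum_antidiagonal_iff_of_nonneg hf).1
    ((hasSum_prod_iff_of_nonneg hf hrow).2 (hy.div_const 4))
  refine hA.congr_fun fun s => ?_
  have h1 : ∑ p ∈ antidiagonal s, 1 / (2 * (p.2 : ℝ) + 1) = oddHarm (s + 1) := by
    rw [← Finset.Nat.sum_antidiagonal_swap]
    exact Finset.Nat.sum_antidiagonal_eq_sum_range_succ (fun i _ => 1 / (2 * (i : ℝ) + 1)) s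
  symm
  calc ∑ p ∈ antidiagonal s, f p
      = ∑ p ∈ antidiagonal s, (1 / ((p.1 : ℝ) + 1) / 2 + 1 / (2 * (p.2 : ℝ) + 1))
          / (((2 * (s + 1) : ℕ) : ℝ) + 1) ^ 2 := by
        refine Finset.sum_congr rfl fun p hp => ?_
        rw [← Finset.HasAntidiagonal.mem_antidiagonal.1 hp]
        simp only [f]
        push_cast
        field_simp
        ring
    _ = _ := by
        rw [← Finset.sum_div, Finset.sum_add_distrib, ← Finset.sum_div,
          sum_antidiagonal_fst_eq_harm, h1, harm_two_mul_succ, add_comm]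

/-- `∑ O_n / n ^ 2 = 7 / 4 ζ(3)`. A quarter of this series is the part of `∑ H_{q-1} / q ^ 2` with
`q` odd. The part with `q` even is again expressed by the series in question, because
`H_{2n-1} = O_n + H_{n-1} / 2`; this gives a linear equation for the sum. -/
theorem hasSum_oddHarm_div_sq :
    HasSum (fun n : ℕ => oddHarm (n + 1) / ((n : ℝ) + 1) ^ 2) (7 / 4 * (riemannZeta 3).re) := by
  obtain ⟨y, hy⟩ := summable_oddHarm_div_sq
  have hodd : HasSum (fun n : ℕ => harm (2 * n + 1) / (((2 * n + 1 : ℕ) : ℝ) + 1) ^ 2)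
      (y / 4 + (riemannZeta 3).re / 8) :=
    ((hy.div_const 4).add (hasSum_harm_div_sq.div_const 8)).congr_fun
      harm_two_mul_add_one_div_sq
  have heven : HasSum (fun n : ℕ => harm (2 * n) / (((2 * n : ℕ) : ℝ) + 1) ^ 2) (y / 4) := by
    have := (hasSum_nat_add_iff
      (f := fun n : ℕ => harm (2 * n) / (((2 * n : ℕ) : ℝ) + 1) ^ 2) 1).1
        (hasSum_harm_two_mul_succ_div_sq hy)
    simpa [harm_zero] using this
  have := (HasSum.even_add_odd (f := fun n : ℕ => harm n / ((n : ℝ) + 1) ^ 2)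
    heven hodd).unique hasSum_harm_div_sq
  rwa [show 7 / 4 * (riemannZeta 3).re = y by linarith]

theorem hasSum_harm_sub_harm_div_sq :
    HasSum (fun n : ℕ => (harm (2 * n + 1) - harm n) / ((n : ℝ) + 1) ^ 2)
      (5 / 4 * (riemannZeta 3).re) := by
  have h := hasSum_oddHarm_div_sq.sub (hasSum_harm_div_sq.div_const 2)
  rw [show 5 / 4 * (riemannZeta 3).re
    = 7 / 4 * (riemannZeta 3).re - (riemannZeta 3).re / 2 by ring]
  refine HasSum.congr_fun h fun n => ?_
  rw [harm_two_mul_add_one]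
  ring

/-! ### The power series of the squared arcsine -/

/-- A power series without constant term and with bounded coefficients may be differentiated term
by term inside the unit disc. -/
theorem hasDerivAt_tsum_pow_succ {c : ℕ → ℝ} {K : ℝ} (hc : ∀ n, |c n| ≤ K) {y : ℝ} (hy : |y| < 1) :
    HasDerivAt (fun z : ℝ => ∑' n, c n * z ^ (n + 1)) (∑' n, c n * ((n + 1) * y ^ n)) y := by
  obtain ⟨ρ, hyρ, hρ⟩ := exists_between hy
  have hρ0 : 0 ≤ ρ := (abs_nonneg y).trans hyρ.le
  have hK : 0 ≤ K := (abs_nonneg _).trans (hc 0)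
  have hu : Summable fun n : ℕ => K * (((n : ℝ) + 1) * ρ ^ n) := by
    have h1 := summable_pow_mul_geometric_of_norm_lt_one (R := ℝ) 1 (r := ρ)
      (by rwa [Real.norm_of_nonneg hρ0])
    have h2 := summable_geometric_of_lt_one hρ0 hρ
    refine ((h1.add h2).mul_left K).congr fun n => ?_
    ring
  have hpre : IsPreconnected (Metric.ball (0 : ℝ) ρ) := (convex_ball (0 : ℝ) ρ).isPreconnected
  refine hasDerivAt_tsum_of_isPreconnected (g := fun n z => c n * z ^ (n + 1))
    (g' := fun n z => c n * ((n + 1) * z ^ n)) (t := Metric.ball (0 : ℝ) ρ) (y₀ := 0) hu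
    Metric.isOpen_ball hpre (fun n z _ => ?_) (fun n z hz => ?_) ?_ ?_ ?_
  · simpa using (hasDerivAt_pow (n + 1) z).const_mul (c n)
  · have hz' : |z| ≤ ρ := by simpa using (mem_ball_zero_iff.1 hz).le
    rw [Real.norm_eq_abs, abs_mul, abs_mul, abs_pow,
      abs_of_nonneg (by positivity : (0 : ℝ) ≤ n + 1)]
    gcongr
    exact hc n
  · simpa using (abs_nonneg y).trans_lt hyρ
  · simp
  · simpa using hyρ

theorem summable_mul_pow {c : ℕ → ℝ} {K : ℝ} (hc : ∀ n, |c n| ≤ K) {y : ℝ} (hy : |y| < 1) :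
    Summable fun n => c n * y ^ n := by
  refine Summable.of_norm_bounded
    ((summable_geometric_of_lt_one (abs_nonneg y) hy).mul_left K) fun n => ?_
  rw [Real.norm_eq_abs, abs_mul, abs_pow]
  gcongr
  exact hc n

theorem summable_mul_succ_mul_pow {c : ℕ → ℝ} {K : ℝ} (hc : ∀ n, |c n| ≤ K) {y : ℝ}
    (hy : |y| < 1) : Summable fun n : ℕ => c n * (((n : ℝ) + 1) * y ^ n) := by
  have h1 := summable_pow_mul_geometric_of_norm_lt_one (R := ℝ) 1 (r := |y|) (by simpa using hy)
  have h2 := summable_geometric_of_lt_one (abs_nonneg y) hy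
  have h3 : Summable fun n : ℕ => K * (((n : ℝ) + 1) * |y| ^ n) :=
    ((h1.add h2).mul_left K).congr fun n => by ring
  refine Summable.of_norm_bounded h3 fun n => ?_
  rw [Real.norm_eq_abs, abs_mul, abs_mul, abs_pow,
      abs_of_nonneg (by positivity : (0 : ℝ) ≤ n + 1)]
  gcongr
  exact hc n

/-- The coefficients `4 ^ m / (m * (2 m choose m))`, `m = n + 1`, of the expansion of
`2 θ tan θ` in powers of `sin θ ^ 2`. -/
noncomputable def arcsinCoeff (n : ℕ) : ℝ :=
  4 ^ (n + 1) / (((n : ℝ) + 1) * (n + 1).centralBinom)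

theorem arcsinCoeff_pos (n : ℕ) : 0 < arcsinCoeff n := by
  have := Nat.centralBinom_pos (n + 1)
  unfold arcsinCoeff
  positivity

theorem arcsinCoeff_zero : arcsinCoeff 0 = 2 := by
  norm_num [arcsinCoeff, Nat.centralBinom, Nat.choose]

theorem abs_arcsinCoeff_le (n : ℕ) : |arcsinCoeff n| ≤ 2 := by
  have := Nat.centralBinom_pos (n + 1)
  rw [abs_of_pos (arcsinCoeff_pos n), arcsinCoeff, div_le_iff₀ (by positivity)]
  have := Nat.four_pow_le_two_mul_self_mul_centralBinom (n + 1) n.succ_pos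
  rw [← mul_assoc]
  exact_mod_cast this

theorem arcsinCoeff_succ (n : ℕ) :
    (2 * (n : ℝ) + 3) * arcsinCoeff (n + 1) = 2 * ((n : ℝ) + 1) * arcsinCoeff n := by
  have h0 : ((n + 1).centralBinom : ℝ) ≠ 0 := by exact_mod_cast (Nat.centralBinom_pos _).ne'
  have h1 : ((n + 1 + 1).centralBinom : ℝ) ≠ 0 := by exact_mod_cast (Nat.centralBinom_pos _).ne'
  have h : ((n : ℝ) + 1 + 1) * (n + 1 + 1).centralBinom
      = 2 * (2 * ((n : ℝ) + 1) + 1) * (n + 1).centralBinom := by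
    exact_mod_cast Nat.succ_mul_centralBinom_succ (n + 1)
  unfold arcsinCoeff
  push_cast
  rw [h]
  field_simp
  ring

theorem abs_arcsinCoeff_div_le (n j : ℕ) : |arcsinCoeff n / ((n : ℝ) + 1) ^ j| ≤ 2 := by
  rw [abs_div, abs_of_pos (by positivity : 0 < ((n : ℝ) + 1) ^ j)]
  exact (div_le_self (abs_nonneg _) (one_le_pow₀ (by linarith [n.cast_nonneg (α := ℝ)]))).trans
    (abs_arcsinCoeff_le n)

/-- The series `∑ 4 ^ m y ^ (m - 1) / (m ^ (j + 1) * (2 m choose m))`. -/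
noncomputable def arcsinSeries (j : ℕ) (y : ℝ) : ℝ :=
  ∑' n : ℕ, arcsinCoeff n / ((n : ℝ) + 1) ^ j * y ^ n

theorem mul_arcsinSeries (j : ℕ) (y : ℝ) :
    y * arcsinSeries j y = ∑' n : ℕ, arcsinCoeff n / ((n : ℝ) + 1) ^ j * y ^ (n + 1) := by
  rw [arcsinSeries, ← tsum_mul_left]
  exact tsum_congr fun n => by ring

theorem hasDerivAt_mul_arcsinSeries (j : ℕ) {y : ℝ} (hy : |y| < 1) :
    HasDerivAt (fun z => z * arcsinSeries (j + 1) z) (arcsinSeries j y) y := by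
  have h := hasDerivAt_tsum_pow_succ (fun n => abs_arcsinCoeff_div_le n (j + 1)) hy
  simp only [mul_arcsinSeries]
  convert h using 1
  refine tsum_congr fun n => ?_
  field_simp
  ring

/-- The differential equation of `2 arcsin x / (x * √(1 - x ^ 2))` in `y = x ^ 2`. -/
theorem arcsinSeries_zero_ode {y : ℝ} (hy : |y| < 1) :
    ∃ D, HasDerivAt (arcsinSeries 0) D y ∧
      (1 - 2 * y) * arcsinSeries 0 y + 2 * y * (1 - y) * D = 2 := by
  have hb1 : ∀ n, |arcsinCoeff (n + 1)| ≤ 2 := fun n => abs_arcsinCoeff_le _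
  have hB : ∀ {z : ℝ}, |z| < 1 →
      arcsinSeries 0 z = 2 + ∑' n : ℕ, arcsinCoeff (n + 1) * z ^ (n + 1) := fun {z} hz => by
    have := (summable_mul_pow abs_arcsinCoeff_le hz).tsum_eq_zero_add
    simpa [arcsinSeries, arcsinCoeff_zero] using this
  refine ⟨∑' n : ℕ, arcsinCoeff (n + 1) * ((n + 1) * y ^ n), ?_, ?_⟩
  · refine ((hasDerivAt_tsum_pow_succ hb1 hy).const_add 2).congr_of_eventuallyEq ?_
    filter_upwards [(continuous_abs.isOpen_preimage _ isOpen_Iio).mem_nhds hy] with z hz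
    exact hB hz
  · have hs0 : HasSum (fun n => arcsinCoeff n * y ^ n) (arcsinSeries 0 y) := by
      have := (summable_mul_pow abs_arcsinCoeff_le hy).hasSum
      simpa [arcsinSeries] using this
    have hs1 : HasSum (fun n => arcsinCoeff (n + 1) * y ^ (n + 1)) (arcsinSeries 0 y - 2) := by
      have := (hasSum_nat_add_iff' 1).2 hs0
      simpa [arcsinCoeff_zero] using this
    have hs2 := (summable_mul_succ_mul_pow hb1 hy).hasSum
    set D := ∑' n : ℕ, arcsinCoeff (n + 1) * (((n : ℝ) + 1) * y ^ n)
    have hs3 : HasSum (fun n : ℕ => arcsinCoeff n * ((n : ℝ) * y ^ n)) (y * D) := by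
      rw [← hasSum_nat_add_iff' 1]
      simp only [Finset.range_one, Finset.sum_singleton, Nat.cast_zero, zero_mul, mul_zero,
        sub_zero]
      refine (hs2.mul_left y).congr_fun fun n => ?_
      push_cast
      ring
    have h := ((hs1.sub (hs0.mul_left (2 * y))).add (hs2.mul_left (2 * y))).sub
      (hs3.mul_left (2 * y))
    have hz : HasSum (fun _ : ℕ => (0 : ℝ)) _ := h.congr_fun fun n => by
      have := arcsinCoeff_succ n
      linear_combination -y ^ (n + 1) * this
    have := hz.unique hasSum_zero
    linear_combination this

theorem eq_of_hasDerivAt_zero {f : ℝ → ℝ} {b : ℝ} (hb : 0 < b)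
    (hc : ContinuousOn f (Set.Icc 0 b)) (hd : ∀ x ∈ Set.Ioo 0 b, HasDerivAt f 0 x) :
    f b = f 0 := by
  obtain ⟨c, -, hc⟩ := exists_hasDerivAt_eq_slope f (fun _ => 0) hb hc hd
  have : b - 0 ≠ 0 := by linarith
  field_simp at hc
  linarith

theorem abs_sin_sq_lt_one {θ : ℝ} (h0 : 0 ≤ θ) (h1 : θ < Real.pi / 2) : |Real.sin θ ^ 2| < 1 := by
  have := Real.cos_pos_of_mem_Ioo ⟨by linarith [Real.pi_pos], h1⟩
  rw [abs_of_nonneg (by positivity), Real.sin_sq]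
  nlinarith

theorem hasDerivAt_sin_sq (θ : ℝ) :
    HasDerivAt (fun t => Real.sin t ^ 2) (2 * Real.sin θ * Real.cos θ) θ := by
  simpa using (Real.hasDerivAt_sin θ).fun_pow 2

theorem sin_mul_cos_mul_arcsinSeries_zero {θ : ℝ} (h0 : 0 ≤ θ) (h1 : θ < Real.pi / 2) :
    Real.sin θ * Real.cos θ * arcsinSeries 0 (Real.sin θ ^ 2) = 2 * θ := by
  rcases h0.eq_or_lt with rfl | hpos
  · simp
  have key : ∀ t, 0 ≤ t → t < Real.pi / 2 → HasDerivAt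
      (fun t => Real.sin t * Real.cos t * arcsinSeries 0 (Real.sin t ^ 2) - 2 * t) 0 t := by
    intro t ht0 ht1
    obtain ⟨D, hD, hode⟩ := arcsinSeries_zero_ode (abs_sin_sq_lt_one ht0 ht1)
    have hB : HasDerivAt (fun t => arcsinSeries 0 (Real.sin t ^ 2))
      (D * (2 * Real.sin t * Real.cos t)) t := 
      HasDerivAt.comp (h₂ := arcsinSeries 0) t hD (hasDerivAt_sin_sq t)
    have := ((((Real.hasDerivAt_sin t).mul (Real.hasDerivAt_cos t)).mul hB).sub
      ((hasDerivAt_id t).const_mul 2))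
    refine this.congr_deriv ?_
    have hs := Real.sin_sq_add_cos_sq t
    have hc : Real.cos t ^ 2 = 1 - Real.sin t ^ 2 := by linarith
    simp only [Pi.mul_apply]
    linear_combination hode +
      (arcsinSeries 0 (Real.sin t ^ 2) + 2 * D * Real.sin t ^ 2) * hc
  have := eq_of_hasDerivAt_zero hpos
    (fun t ht => (key t ht.1 (ht.2.trans_lt h1)).continuousAt.continuousWithinAt)
    (fun t ht => key t ht.1.le (ht.2.trans h1))
  simp at this
  linarith

/-- The expansion `∑ (2 sin θ) ^ (2 m) / (m ^ 2 * (2 m choose m)) = 2 θ ^ 2`. -/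
theorem sin_sq_mul_arcsinSeries_one {θ : ℝ} (h0 : 0 ≤ θ) (h1 : θ < Real.pi / 2) :
    Real.sin θ ^ 2 * arcsinSeries 1 (Real.sin θ ^ 2) = 2 * θ ^ 2 := by
  rcases h0.eq_or_lt with rfl | hpos
  · simp
  have key : ∀ t, 0 ≤ t → t < Real.pi / 2 → HasDerivAt
      (fun t => Real.sin t ^ 2 * arcsinSeries 1 (Real.sin t ^ 2) - 2 * t ^ 2) 0 t := by
    intro t ht0 ht1
    have hA : HasDerivAt (fun t => Real.sin t ^ 2 * arcsinSeries 1 (Real.sin t ^ 2)) _ t :=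
      HasDerivAt.comp (h₂ := fun z => z * arcsinSeries 1 z) t
        (hasDerivAt_mul_arcsinSeries 0 (abs_sin_sq_lt_one ht0 ht1)) (hasDerivAt_sin_sq t)
    refine (hA.sub ((hasDerivAt_pow 2 t).const_mul 2)).congr_deriv ?_
    have := sin_mul_cos_mul_arcsinSeries_zero ht0 ht1
    push_cast
    linear_combination 2 * this
  have := eq_of_hasDerivAt_zero hpos
    (fun t ht => (key t ht.1 (ht.2.trans_lt h1)).continuousAt.continuousWithinAt)
    (fun t ht => key t ht.1.le (ht.2.trans h1))
  simp at this
  linarith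

theorem hasDerivAt_sin_sq_mul_arcsinSeries_two {θ : ℝ} (h0 : 0 ≤ θ) (h1 : θ < Real.pi / 2) :
    HasDerivAt (fun t => Real.sin t ^ 2 * arcsinSeries 2 (Real.sin t ^ 2))
      (arcsinSeries 1 (Real.sin θ ^ 2) * (2 * Real.sin θ * Real.cos θ)) θ :=
  HasDerivAt.comp (h₂ := fun z => z * arcsinSeries 2 z) θ
    (hasDerivAt_mul_arcsinSeries 1 (abs_sin_sq_lt_one h0 h1)) (hasDerivAt_sin_sq θ)

/-! ### The derivative of Clausen's function -/

/-- The cosine series `∑ cos (m x) / m ^ 3`. -/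
noncomputable def cosSeriesThree (x : ℝ) : ℝ :=
  ∑' n : ℕ, Real.cos (((n : ℝ) + 1) * x) / ((n : ℝ) + 1) ^ 3

/-- The Abel means `∑ r ^ m sin (m x) / m ^ 2` of Clausen's function. -/
noncomputable def clausenAbel (r x : ℝ) : ℝ :=
  ∑' n : ℕ, r ^ (n + 1) * Real.sin (((n : ℝ) + 1) * x) / ((n : ℝ) + 1) ^ 2

theorem clausenTwo_eq_tsum_nat (x : ℝ) :
    clausenTwo x = ∑' n : ℕ, Real.sin (((n : ℝ) + 1) * x) / ((n : ℝ) + 1) ^ 2 := by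
  rw [clausenTwo, tsum_pnat_eq_tsum_succ (f := fun n : ℕ => Real.sin ((n : ℝ) * x) / (n : ℝ) ^ 2)]
  simp

theorem summable_one_div_succ_pow {k : ℕ} (hk : 1 < k) :
    Summable fun n : ℕ => 1 / ((n : ℝ) + 1) ^ k := by
  simpa using (summable_nat_add_iff 1).2 (Real.summable_one_div_nat_pow.2 hk)

theorem continuous_clausenTwo : Continuous clausenTwo := by
  rw [show clausenTwo = _ from funext clausenTwo_eq_tsum_nat]
  refine continuous_tsum (fun n => by fun_prop) (summable_one_div_succ_pow one_lt_two)
    fun n x => ?_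
  rw [norm_div, Real.norm_of_nonneg (by positivity : 0 ≤ ((n : ℝ) + 1) ^ 2)]
  gcongr
  exact Real.abs_sin_le_one _

theorem hasDerivAt_cosSeriesThree (x : ℝ) : HasDerivAt cosSeriesThree (-clausenTwo x) x := by
  rw [clausenTwo_eq_tsum_nat, ← tsum_neg]
  refine hasDerivAt_tsum
    (g := fun (n : ℕ) (y : ℝ) => Real.cos (((n : ℝ) + 1) * y) / ((n : ℝ) + 1) ^ 3)
    (g' := fun (n : ℕ) (y : ℝ) => -(Real.sin (((n : ℝ) + 1) * y) / ((n : ℝ) + 1) ^ 2))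
    (y₀ := 0) (summable_one_div_succ_pow one_lt_two) (fun n y => ?_) (fun n y => ?_) ?_ x
  · refine ((((hasDerivAt_id y).const_mul ((n : ℝ) + 1)).cos).div_const
      (((n : ℝ) + 1) ^ 3)).congr_deriv ?_
    simp only [id]
    field_simp
  · rw [norm_neg, norm_div, Real.norm_of_nonneg (by positivity : 0 ≤ ((n : ℝ) + 1) ^ 2)]
    gcongr
    exact Real.abs_sin_le_one _
  · simpa using summable_one_div_succ_pow (k := 3) (by norm_num)

theorem hasSum_pow_mul_cos_div {r : ℝ} (h0 : 0 ≤ r) (h1 : r < 1) (x : ℝ) :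
    HasSum (fun n : ℕ => r ^ (n + 1) * Real.cos (((n : ℝ) + 1) * x) / ((n : ℝ) + 1))
      (-(Real.log (1 - 2 * r * Real.cos x + r ^ 2) / 2)) := by
  set z : ℂ := r * Complex.exp (x * Complex.I) with hz
  have hnz : ‖z‖ < 1 := by
    rw [hz, norm_mul, Complex.norm_exp_ofReal_mul_I, mul_one, Complex.norm_real,
      Real.norm_of_nonneg h0]
    exact h1
  have h := Complex.hasSum_re (Complex.hasSum_taylorSeries_neg_log' hnz)
  have hre : (-Complex.log (1 - z)).re = -(Real.log (1 - 2 * r * Real.cos x + r ^ 2) / 2) := by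
    rw [Complex.neg_re, Complex.log_re]
    have : ‖1 - z‖ ^ 2 = 1 - 2 * r * Real.cos x + r ^ 2 := by
      rw [Complex.sq_norm, Complex.normSq_apply, hz, Complex.exp_mul_I, ← Complex.ofReal_cos,
        ← Complex.ofReal_sin]
      simp [-Complex.ofReal_cos, -Complex.ofReal_sin]
      linear_combination r ^ 2 * Real.sin_sq_add_cos_sq x
    rw [← this, Real.log_pow]
    push_cast
    ring
  rw [hre] at h
  refine h.congr_fun fun n => ?_
  rw [hz, mul_pow, ← Complex.exp_nat_mul]
  have : (((n + 1 : ℕ) : ℂ) * (x * Complex.I)) = ((((n : ℝ) + 1) * x : ℝ) : ℂ) * Complex.I := by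
    push_cast
    ring
  rw [this, show ((n : ℂ) + 1) = (((n : ℝ) + 1 : ℝ) : ℂ) by push_cast; rfl, Complex.div_ofReal_re,
    ← Complex.ofReal_pow, Complex.re_ofReal_mul, Complex.exp_ofReal_mul_I_re]

theorem hasDerivAt_clausenAbel {r : ℝ} (h0 : 0 ≤ r) (h1 : r < 1) (x : ℝ) :
    HasDerivAt (clausenAbel r) (-(Real.log (1 - 2 * r * Real.cos x + r ^ 2) / 2)) x := by
  rw [← (hasSum_pow_mul_cos_div h0 h1 x).tsum_eq]
  have hu : Summable fun n : ℕ => r ^ (n + 1) :=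
    (summable_nat_add_iff 1).2 (summable_geometric_of_lt_one h0 h1)
  refine hasDerivAt_tsum
    (g := fun (n : ℕ) (y : ℝ) => r ^ (n + 1) * Real.sin (((n : ℝ) + 1) * y) / ((n : ℝ) + 1) ^ 2)
    (g' := fun (n : ℕ) (y : ℝ) => r ^ (n + 1) * Real.cos (((n : ℝ) + 1) * y) / ((n : ℝ) + 1))
    (y₀ := 0) hu (fun n y => ?_) (fun n y => ?_) ?_ x
  · refine (((((hasDerivAt_id y).const_mul ((n : ℝ) + 1)).sin).const_mul (r ^ (n + 1))).div_const
      (((n : ℝ) + 1) ^ 2)).congr_deriv ?_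
    simp only [id]
    field_simp
  · have hn : (1 : ℝ) ≤ (n : ℝ) + 1 := by linarith [n.cast_nonneg (α := ℝ)]
    rw [norm_div, norm_mul, norm_pow, Real.norm_of_nonneg h0,
      Real.norm_of_nonneg (by linarith : 0 ≤ (n : ℝ) + 1)]
    calc _ ≤ r ^ (n + 1) * 1 / 1 := by
          gcongr
          exact Real.abs_cos_le_one _
      _ = _ := by ring
  · simp

theorem tendsto_clausenAbel (x : ℝ) :
    Filter.Tendsto (fun r => clausenAbel r x) (𝓝[<] 1) (𝓝 (clausenTwo x)) := by
  rw [clausenTwo_eq_tsum_nat]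
  refine tendsto_tsum_of_dominated_convergence (summable_one_div_succ_pow one_lt_two)
    (fun n => ?_) ?_
  · have : Continuous fun r : ℝ =>
      r ^ (n + 1) * Real.sin (((n : ℝ) + 1) * x) / ((n : ℝ) + 1) ^ 2 := by fun_prop
    simpa using (this.tendsto 1).mono_left nhdsWithin_le_nhds
  · filter_upwards [Ioo_mem_nhdsLT (zero_lt_one' ℝ)] with r hr n
    rw [norm_div, norm_mul, norm_pow, Real.norm_of_nonneg hr.1.le,
      Real.norm_of_nonneg (by positivity : 0 ≤ ((n : ℝ) + 1) ^ 2)]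
    gcongr
    exact mul_le_one₀ (pow_le_one₀ hr.1.le hr.2.le) (norm_nonneg _) (Real.abs_sin_le_one _)

/-- Clausen's function is an antiderivative of `-log (2 sin (x / 2))`. The derivatives of the Abel
means converge locally uniformly, being the restrictions of a continuous function of `(r, x)`. -/
theorem hasDerivAt_clausenTwo {x : ℝ} (hx : x ∈ Set.Ioo 0 Real.pi) :
    HasDerivAt clausenTwo (-Real.log (2 * Real.sin (x / 2))) x := by
  have hlim : TendstoLocallyUniformlyOn
      (fun r x => -(Real.log (1 - 2 * r * Real.cos x + r ^ 2) / 2))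
      (fun x => -(Real.log (1 - 2 * 1 * Real.cos x + 1 ^ 2) / 2)) (𝓝[<] (1 : ℝ))
      (Set.Ioo 0 Real.pi) := by
    rw [tendstoLocallyUniformlyOn_iff_forall_isCompact isOpen_Ioo]
    intro K hKs hK u hu
    have hcont : ContinuousOn
        (Function.uncurry fun r x : ℝ => -(Real.log (1 - 2 * r * Real.cos x + r ^ 2) / 2))
        (Set.univ ×ˢ K) := by
      refine ((ContinuousOn.log (by fun_prop) fun p hp => ?_).div_const 2).neg
      have hs : 0 < Real.sin p.2 := Real.sin_pos_of_mem_Ioo (hKs hp.2)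
      have := Real.sin_sq_add_cos_sq p.2
      nlinarith [sq_nonneg (p.1 - Real.cos p.2)]
    obtain ⟨v, hv, h⟩ := hK.mem_uniformity_of_prod hcont (Set.mem_univ 1)
      (UniformSpace.symm hu)
    rw [nhdsWithin_univ] at hv
    filter_upwards [mem_nhdsWithin_of_mem_nhds hv] with r hr y hy
    exact h r hr y hy
  have h := hasDerivAt_of_tendstoLocallyUniformlyOn isOpen_Ioo hlim
    (by
      filter_upwards [Ioo_mem_nhdsLT (zero_lt_one' ℝ)] with r hr y _
      exact hasDerivAt_clausenAbel hr.1.le hr.2 y)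
    (fun y _ => tendsto_clausenAbel y) hx
  refine h.congr_deriv ?_
  have : (1 : ℝ) - 2 * 1 * Real.cos x + 1 ^ 2 = (2 * Real.sin (x / 2)) ^ 2 := by
    have h2 := Real.cos_two_mul (x / 2)
    rw [show 2 * (x / 2) = x by ring] at h2
    linear_combination -2 * h2 - 4 * Real.sin_sq_add_cos_sq (x / 2)
  rw [this, Real.log_pow]
  push_cast
  ring

/-! ### The cosine series at `π / 3` -/

/-- At `π / 3` the cosine is a combination of divisibility indicators. -/
theorem cos_mul_pi_div_three (n : ℕ) : Real.cos (n * (Real.pi / 3)) =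
    1 / 2 - (if 2 ∣ n then 1 else 0) - 3 / 2 * (if 3 ∣ n then 1 else 0)
      + 3 * (if 6 ∣ n then 1 else 0) := by
  obtain ⟨q, r, hr, rfl⟩ : ∃ q r, r < 6 ∧ n = r + 6 * q :=
    ⟨n / 6, n % 6, Nat.mod_lt _ (by norm_num), (Nat.mod_add_div n 6).symm⟩
  have hper : ((r + 6 * q : ℕ) : ℝ) * (Real.pi / 3) = r * (Real.pi / 3) + q * (2 * Real.pi) := by
    push_cast
    ring
  rw [hper, Real.cos_add_nat_mul_two_pi]
  have h2 : 2 ∣ r + 6 * q ↔ 2 ∣ r := by omega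
  have h3 : 3 ∣ r + 6 * q ↔ 3 ∣ r := by omega
  have h6 : 6 ∣ r + 6 * q ↔ 6 ∣ r := by omega
  simp only [h2, h3, h6]
  interval_cases r
  · norm_num
  · norm_num
  · rw [show ((2 : ℕ) : ℝ) * (Real.pi / 3) = Real.pi - Real.pi / 3 by push_cast; ring,
      Real.cos_pi_sub]
    norm_num
  · rw [show ((3 : ℕ) : ℝ) * (Real.pi / 3) = Real.pi by push_cast; ring]
    norm_num
  · rw [show ((4 : ℕ) : ℝ) * (Real.pi / 3) = Real.pi / 3 + Real.pi by push_cast; ring,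
      Real.cos_add_pi]
    norm_num
  · rw [show ((5 : ℕ) : ℝ) * (Real.pi / 3) = 2 * Real.pi - Real.pi / 3 by push_cast; ring,
      Real.cos_two_pi_sub]
    norm_num

theorem hasSum_ite_dvd_div_cube {d : ℕ} (hd : 0 < d) :
    HasSum (fun n : ℕ => (if d ∣ n + 1 then (1 : ℝ) else 0) / ((n : ℝ) + 1) ^ 3)
      ((riemannZeta 3).re / (d : ℝ) ^ 3) := by
  have hinj : Function.Injective fun n : ℕ => d * (n + 1) - 1 := fun a b h => by
    have ha : 0 < d * (a + 1) := by positivity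
    have hb : 0 < d * (b + 1) := by positivity
    have : d * (a + 1) = d * (b + 1) := by dsimp only at h; omega
    have := Nat.eq_of_mul_eq_mul_left hd this
    omega
  rw [← hinj.hasSum_iff]
  · refine (hasSum_zeta_three.div_const ((d : ℝ) ^ 3)).congr_fun fun n => ?_
    have ha : 0 < d * (n + 1) := by positivity
    have h1 : d * (n + 1) - 1 + 1 = d * (n + 1) := by omega
    have h2 : ((d * (n + 1) - 1 : ℕ) : ℝ) + 1 = d * ((n : ℝ) + 1) := by exact_mod_cast h1
    simp only [Function.comp_apply, h1, h2, dvd_mul_right, if_true]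
    rw [mul_pow, div_div, mul_comm]
  · intro n hn
    rw [if_neg, zero_div]
    rintro ⟨k, hk⟩
    refine hn ⟨k - 1, ?_⟩
    have : k ≠ 0 := by rintro rfl; omega
    have h1 : k - 1 + 1 = k := by omega
    simp only [h1, ← hk]
    omega

theorem cosSeriesThree_pi_div_three : cosSeriesThree (Real.pi / 3) = (riemannZeta 3).re / 3 := by
  have h := ((((hasSum_zeta_three.div_const 2).sub (hasSum_ite_dvd_div_cube two_pos)).sub
    ((hasSum_ite_dvd_div_cube three_pos).mul_left (3 / 2))).add
    ((hasSum_ite_dvd_div_cube (show 0 < 6 by norm_num)).mul_left 3))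
  rw [cosSeriesThree]
  refine HasSum.tsum_eq ?_
  have hval : (riemannZeta 3).re / 3 = (riemannZeta 3).re / 2
      - (riemannZeta 3).re / ((2 : ℕ) : ℝ) ^ 3 - 3 / 2 * ((riemannZeta 3).re / ((3 : ℕ) : ℝ) ^ 3)
      + 3 * ((riemannZeta 3).re / ((6 : ℕ) : ℝ) ^ 3) := by
    push_cast
    ring
  rw [hval]
  refine h.congr_fun fun n => ?_
  have := cos_mul_pi_div_three (n + 1)
  push_cast at this
  rw [this]
  ring

theorem cosSeriesThree_zero : cosSeriesThree 0 = (riemannZeta 3).re := by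
  rw [cosSeriesThree, ← hasSum_zeta_three.tsum_eq]
  simp

/-! ### The inverse cubes with central binomial coefficients -/

theorem tendsto_sq_mul_log_two_mul_sin :
    Filter.Tendsto (fun t : ℝ => t ^ 2 * Real.log (2 * Real.sin t)) (𝓝[>] 0) (𝓝 0) := by
  have hlim : Filter.Tendsto
      (fun t : ℝ => Real.pi / 4 * t * |2 * Real.sin t * Real.log (2 * Real.sin t)|)
      (𝓝[>] 0) (𝓝 0) := by
    have hc : Continuous fun t : ℝ => 2 * Real.sin t * Real.log (2 * Real.sin t) :=
      Real.continuous_mul_log.comp (continuous_const.mul Real.continuous_sin)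
    have : Continuous fun t : ℝ =>
        Real.pi / 4 * t * |2 * Real.sin t * Real.log (2 * Real.sin t)| := by fun_prop
    simpa using (this.tendsto 0).mono_left nhdsWithin_le_nhds
  refine squeeze_zero_norm' ?_ hlim
  filter_upwards [Ioo_mem_nhdsGT (by positivity : (0 : ℝ) < Real.pi / 2)] with t ht
  -- Jordan's inequality bounds one of the two factors `t`
  have hj : t ≤ Real.pi / 2 * Real.sin t := by
    have := mul_le_mul_of_nonneg_left (Real.mul_le_sin ht.1.le ht.2.le)
      (by positivity : 0 ≤ Real.pi / 2)
    rwa [← mul_assoc, div_mul_div_cancel₀ (by norm_num), div_self Real.pi_ne_zero, one_mul] at this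
  have hs : 0 < Real.sin t := Real.sin_pos_of_pos_of_lt_pi ht.1 (by linarith [ht.2, Real.pi_pos])
  rw [Real.norm_eq_abs, abs_mul, abs_mul, abs_of_pos (by positivity : 0 < 2 * Real.sin t),
    abs_of_nonneg (sq_nonneg t)]
  have := mul_le_mul_of_nonneg_right (mul_le_mul_of_nonneg_left hj ht.1.le)
    (abs_nonneg (Real.log (2 * Real.sin t)))
  linarith

/-- Both sides have the derivative `4 θ ^ 2 cot θ` and vanish at `0`. -/
theorem sin_sq_mul_arcsinSeries_two {θ : ℝ} (h0 : 0 < θ) (h1 : θ < Real.pi / 2) :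
    Real.sin θ ^ 2 * arcsinSeries 2 (Real.sin θ ^ 2) =
      4 * (θ ^ 2 * Real.log (2 * Real.sin θ)) + 4 * θ * clausenTwo (2 * θ)
        + 2 * cosSeriesThree (2 * θ) - 2 * (riemannZeta 3).re := by
  let F : ℝ → ℝ := fun t => Real.sin t ^ 2 * arcsinSeries 2 (Real.sin t ^ 2)
    - 4 * (t ^ 2 * Real.log (2 * Real.sin t)) - 4 * t * clausenTwo (2 * t)
    - 2 * cosSeriesThree (2 * t)
  have hder : ∀ t, 0 < t → t < Real.pi / 2 → HasDerivAt F 0 t := by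
    intro t ht0 ht1
    have hs : 0 < Real.sin t := Real.sin_pos_of_pos_of_lt_pi ht0 (by linarith)
    have hcl : HasDerivAt (fun t => clausenTwo (2 * t)) (-Real.log (2 * Real.sin t) * 2) t := by
      have h := (hasDerivAt_clausenTwo (x := 2 * t) ⟨by linarith, by linarith⟩)
      rw [mul_div_cancel_left₀ t two_ne_zero] at h
      exact h.comp t (by simpa using (hasDerivAt_id t).const_mul 2)
    have hc3 : HasDerivAt (fun t => cosSeriesThree (2 * t)) (-clausenTwo (2 * t) * 2) t :=
      (hasDerivAt_cosSeriesThree (2 * t)).comp t (by simpa using (hasDerivAt_id t).const_mul 2)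
    have hlog : HasDerivAt (fun t => Real.log (2 * Real.sin t))
        (2 * Real.cos t / (2 * Real.sin t)) t :=
      ((Real.hasDerivAt_sin t).const_mul 2).log (by positivity)
    have h2 := sin_sq_mul_arcsinSeries_one ht0.le ht1
    refine ((((hasDerivAt_sin_sq_mul_arcsinSeries_two ht0.le ht1).sub
      (((hasDerivAt_pow 2 t).mul hlog).const_mul 4)).sub
      (((hasDerivAt_id t).const_mul 4).mul hcl)).sub (hc3.const_mul 2)).congr_deriv ?_
    simp only [id]
    push_cast
    field_simp
    linear_combination 2 * Real.cos t * h2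
  have hcont : ContinuousOn F (Set.Icc 0 θ) := by
    intro t ht
    rcases ht.1.eq_or_lt with rfl | hpos
    · have hlog : ContinuousWithinAt (fun t : ℝ => t ^ 2 * Real.log (2 * Real.sin t))
          (Set.Icc 0 θ) 0 := by
        rw [← continuousWithinAt_sdiff_self]
        refine Filter.Tendsto.mono_left ?_
          (nhdsWithin_mono 0 (t := Set.Ioi 0) fun t ht => ht.1.1.lt_of_ne' ht.2)
        simpa using tendsto_sq_mul_log_two_mul_sin
      have hA := (hasDerivAt_sin_sq_mul_arcsinSeries_two le_rfl
        (by positivity : (0 : ℝ) < Real.pi / 2)).continuousAt.continuousWithinAt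
        (s := Set.Icc 0 θ)
      have hcl : Continuous fun t => 4 * t * clausenTwo (2 * t) :=
        (continuous_const.mul continuous_id).mul
          (continuous_clausenTwo.comp (continuous_const.mul continuous_id))
      have hc3 : Continuous fun t => 2 * cosSeriesThree (2 * t) :=
        continuous_const.mul ((continuous_iff_continuousAt.2 fun x =>
          (hasDerivAt_cosSeriesThree x).continuousAt).comp (continuous_const.mul continuous_id))
      exact ((hA.sub (continuousWithinAt_const.mul hlog)).sub hcl.continuousWithinAt).sub
        hc3.continuousWithinAt
    · exact (hder t hpos (ht.2.trans_lt h1)).continuousAt.continuousWithinAt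
  have := eq_of_hasDerivAt_zero h0 hcont fun t ht => hder t ht.1 (ht.2.trans h1)
  simp [F, cosSeriesThree_zero] at this
  linarith

/-- `∑ 1 / (m ^ 3 * (2 m choose m)) = 2 π / 3 Cl₂(π / 3) - 4 / 3 ζ(3)`. -/
theorem hasSum_one_div_cube_mul_centralBinom :
    HasSum (fun n : ℕ => 1 / (((n : ℝ) + 1) ^ 3 * (n + 1).centralBinom))
      (2 * Real.pi / 3 * clausenTwo (Real.pi / 3) - 4 / 3 * (riemannZeta 3).re) := by
  have h := sin_sq_mul_arcsinSeries_two (θ := Real.pi / 6) (by positivity)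
    (by linarith [Real.pi_pos])
  have hy : |(1 / 4 : ℝ)| < 1 := by norm_num [abs_lt]
  have hs := ((summable_mul_pow (fun n => abs_arcsinCoeff_div_le n 2) hy).hasSum).mul_left (1 / 4)
  rw [Real.sin_pi_div_six, show 2 * (Real.pi / 6) = Real.pi / 3 by ring,
    cosSeriesThree_pi_div_three] at h
  norm_num at h
  rw [← arcsinSeries, h] at hs
  have hval : 2 * Real.pi / 3 * clausenTwo (Real.pi / 3) - 4 / 3 * (riemannZeta 3).re
      = 4 * (Real.pi / 6) * clausenTwo (Real.pi / 3) + 2 * ((riemannZeta 3).re / 3)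
        - 2 * (riemannZeta 3).re := by ring
  rw [hval]
  refine hs.congr_fun fun n => ?_
  have : ((n + 1).centralBinom : ℝ) ≠ 0 := by exact_mod_cast (Nat.centralBinom_pos _).ne'
  rw [arcsinCoeff, one_div_pow]
  field_simp
  ring

/-! ### Summation over `n + k = m` -/

open scoped Nat in
theorem sum_descFactorial_mul_factorial (m d : ℕ) :
    ∑ i ∈ Finset.range (m + 1), (m.descFactorial i : ℝ) * (m + d - i)! / (m + d + 1)!
      = 1 / ((d : ℝ) + 1) := by
  induction m with
  | zero =>
    have := Nat.factorial_pos d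
    simp [Nat.factorial_succ]
    field_simp
  | succ m ih =>
    have hstep : ∀ i, ((m + 1).descFactorial (i + 1) : ℝ) * (m + 1 + d - (i + 1))!
        / (m + 1 + d + 1)! = ((m : ℝ) + 1) / (m + d + 2) *
          ((m.descFactorial i : ℝ) * (m + d - i)! / (m + d + 1)!) := fun i => by
      rw [Nat.succ_descFactorial_succ, show m + 1 + d - (i + 1) = m + d - i by omega,
        show m + 1 + d + 1 = m + d + 1 + 1 by ring, Nat.factorial_succ (m + d + 1)]
      have := Nat.factorial_pos (m + d + 1)
      push_cast
      field_simp
      ring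
    rw [Finset.sum_range_succ']
    simp only [hstep]
    rw [← Finset.mul_sum, ih, Nat.descFactorial_zero, Nat.sub_zero, Nat.factorial_succ (m + 1 + d)]
    have := Nat.factorial_pos (m + 1 + d)
    push_cast
    field_simp
    ring

open scoped Nat in
/-- The value of `∫ t in 0..1, (t ^ (N - m) - t ^ N) / (1 - t)`, with the numerator expanded by the
binomial theorem for `(t + (1 - t)) ^ m` and each term integrated as a Beta integral. -/
theorem sum_choose_mul_factorial_mul_factorial (m N : ℕ) (h : m ≤ N) :
    ∑ i ∈ Finset.range m, (m.choose (i + 1) : ℝ) * i ! * (N - 1 - i)! / N !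
      = harm N - harm (N - m) := by
  induction m with
  | zero => simp
  | succ m ih =>
    obtain ⟨d, rfl⟩ := Nat.exists_eq_add_of_le h
    have h1 : ∀ i, ((m + 1).choose (i + 1) : ℝ) * i ! * (m + 1 + d - 1 - i)! / (m + 1 + d)!
        = (m.descFactorial i : ℝ) * (m + d - i)! / (m + d + 1)!
          + (m.choose (i + 1) : ℝ) * i ! * (m + 1 + d - 1 - i)! / (m + 1 + d)! := fun i => by
      rw [Nat.choose_succ_succ, Nat.descFactorial_eq_factorial_mul_choose,
        show m + 1 + d - 1 - i = m + d - i by omega, show m + 1 + d = m + d + 1 by ring]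
      push_cast
      ring
    simp only [h1]
    rw [Finset.sum_add_distrib, sum_descFactorial_mul_factorial, Finset.sum_range_succ _ m,
      ih (by omega), show m + 1 + d - m = d + 1 by omega, show m + 1 + d - (m + 1) = d by omega,
      harm_succ d, Nat.choose_succ_self]
    push_cast
    ring

open scoped Nat in
theorem gammaTerm_succPNat (i j : ℕ) :
    gammaTerm i.succPNat j.succPNat = ((i + j + 2).choose (i + 1) : ℝ) * i ! *
      (i + 2 * j + 2)! / (2 * (i + j) + 3)! / ((i : ℝ) + j + 2) ^ 2 := by
  have h1 : Real.Gamma (((i.succPNat : ℕ) : ℝ) + ((j.succPNat : ℕ) : ℝ)) = (i + j + 1)! := by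
    rw [← Real.Gamma_nat_eq_factorial]
    congr 1
    push_cast [Nat.succPNat_coe]
    ring
  have h2 : Real.Gamma (((i.succPNat : ℕ) : ℝ) + 2 * ((j.succPNat : ℕ) : ℝ))
      = (i + 2 * j + 2)! := by
    rw [← Real.Gamma_nat_eq_factorial]
    congr 1
    push_cast [Nat.succPNat_coe]
    ring
  have h3 : Real.Gamma (2 * ((i.succPNat : ℕ) : ℝ) + 2 * ((j.succPNat : ℕ) : ℝ))
      = (2 * (i + j) + 3)! := by
    rw [← Real.Gamma_nat_eq_factorial]
    congr 1
    push_cast [Nat.succPNat_coe]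
    ring
  have hc : ((i + j + 2).choose (i + 1) : ℝ) * (((i : ℝ) + 1) * i !) * (j + 1)!
      = ((i : ℝ) + j + 2) * (i + j + 1)! := by
    have := Nat.choose_mul_factorial_mul_factorial (show i + 1 ≤ i + j + 2 by omega)
    rw [show i + j + 2 - (i + 1) = j + 1 by omega, Nat.factorial_succ (i + j + 1),
      Nat.factorial_succ i] at this
    exact_mod_cast this
  have p1 := Nat.factorial_pos (j + 1)
  have p2 := Nat.factorial_pos (2 * (i + j) + 3)
  have p3 := Nat.factorial_pos i
  have hc' : ((i + j + 2).choose (i + 1) : ℝ)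
      = ((i : ℝ) + j + 2) * (i + j + 1)! / ((((i : ℝ) + 1) * i !) * (j + 1)!) := by
    rw [eq_div_iff (by positivity), ← hc]
    ring
  rw [gammaTerm, h1, h2, h3, hc', Nat.succPNat_coe, Nat.succPNat_coe, Nat.succ_eq_add_one,
    Nat.succ_eq_add_one]
  push_cast
  field_simp
  ring

theorem gammaTerm_nonneg (n k : ℕ+) : 0 ≤ gammaTerm n k := by
  have hn : (0 : ℝ) < n := by exact_mod_cast n.pos
  have hk : (0 : ℝ) < k := by exact_mod_cast k.pos
  have h1 := Real.Gamma_pos_of_pos (show (0 : ℝ) < (n : ℝ) + k by positivity)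
  have h2 := Real.Gamma_pos_of_pos (show (0 : ℝ) < (n : ℝ) + 2 * k by positivity)
  have h3 := Real.Gamma_pos_of_pos (show (0 : ℝ) < 2 * (n : ℝ) + 2 * k by positivity)
  unfold gammaTerm
  positivity

open scoped Nat in
theorem factorial_mul_factorial_div (m : ℕ) :
    (m ! : ℝ) * m ! / (2 * m + 1)! = 2 / (((m : ℝ) + 1) * (m + 1).centralBinom) := by
  have h : ((m + 1).centralBinom : ℝ) * (((m : ℝ) + 1) * m !) * (((m : ℝ) + 1) * m !)
      = (2 * (m : ℝ) + 2) * (2 * m + 1)! := by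
    have := Nat.add_choose_mul_factorial_mul_factorial (m + 1) (m + 1)
    rw [← two_mul, ← Nat.centralBinom_eq_two_mul_choose, show 2 * (m + 1) = 2 * m + 1 + 1 by ring,
      Nat.factorial_succ (2 * m + 1), Nat.factorial_succ m] at this
    exact_mod_cast this
  have p1 := Nat.factorial_pos (2 * m + 1)
  have p2 := Nat.centralBinom_pos (m + 1)
  have p3 : (0 : ℝ) < (m : ℝ) + 1 := by positivity
  rw [div_eq_div_iff (by positivity) (by positivity)]
  refine mul_left_cancel₀ p3.ne' ?_
  linear_combination h

/-- The part of the double series with `n + k = m`, `m = s + 2`. -/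
theorem sum_antidiagonal_gammaTerm (s : ℕ) :
    ∑ p ∈ antidiagonal s, gammaTerm p.1.succPNat p.2.succPNat =
      (harm (2 * (s + 1) + 1) - harm (s + 1)) / (((s + 1 : ℕ) : ℝ) + 1) ^ 2
        - 2 * (1 / ((((s + 1 : ℕ) : ℝ) + 1) ^ 3 * (s + 1 + 1).centralBinom)) := by
  have h := sum_choose_mul_factorial_mul_factorial (s + 2) (2 * s + 3) (by omega)
  -- the term `i = s + 1` of the sum, `n = m` and `k = 0`, does not belong to the double series
  rw [Finset.sum_range_succ, show 2 * s + 3 - (s + 2) = s + 1 by omega,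
    show 2 * s + 3 - 1 - (s + 1) = s + 1 by omega, Nat.choose_self, Nat.cast_one, one_mul,
    show 2 * s + 3 = 2 * (s + 1) + 1 by ring, factorial_mul_factorial_div] at h
  have h2 : ∑ p ∈ antidiagonal s, gammaTerm p.1.succPNat p.2.succPNat =
      (∑ i ∈ Finset.range (s + 1), ((s + 2).choose (i + 1) : ℝ) * i.factorial *
        (2 * (s + 1) + 1 - 1 - i).factorial / (2 * (s + 1) + 1).factorial)
          / ((s : ℝ) + 2) ^ 2 := by
    rw [← Finset.Nat.sum_antidiagonal_eq_sum_range_succ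
      (fun i _ => ((s + 2).choose (i + 1) : ℝ) * i.factorial *
        (2 * (s + 1) + 1 - 1 - i).factorial / (2 * (s + 1) + 1).factorial), Finset.sum_div]
    refine Finset.sum_congr rfl fun p hp => ?_
    have hs := Finset.HasAntidiagonal.mem_antidiagonal.1 hp
    have hs' : (p.1 : ℝ) + p.2 = s := by exact_mod_cast hs
    rw [gammaTerm_succPNat, hs, hs', show p.1 + 2 * p.2 + 2 = 2 * (s + 1) + 1 - 1 - p.1 by omega,
      show 2 * s + 3 = 2 * (s + 1) + 1 by ring]
  have p2 := Nat.centralBinom_pos (s + 1 + 1)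
  rw [h2, eq_sub_of_add_eq h]
  push_cast
  field_simp
  ring

theorem hasSum_gammaTerm_succPNat :
    HasSum (fun p : ℕ × ℕ => gammaTerm p.1.succPNat p.2.succPNat)
      (47 / 12 * (riemannZeta 3).re - 4 * Real.pi / 3 * clausenTwo (Real.pi / 3)) := by
  rw [hasSum_antidiagonal_iff_of_nonneg fun p => gammaTerm_nonneg _ _]
  simp only [sum_antidiagonal_gammaTerm]
  have h := (hasSum_nat_add_iff' 1).2
    (hasSum_harm_sub_harm_div_sq.sub (hasSum_one_div_cube_mul_centralBinom.mul_left 2))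
  -- the two terms with `m = 1` cancel
  have hval : 47 / 12 * (riemannZeta 3).re - 4 * Real.pi / 3 * clausenTwo (Real.pi / 3)
      = 5 / 4 * (riemannZeta 3).re - 2 * (2 * Real.pi / 3 * clausenTwo (Real.pi / 3)
        - 4 / 3 * (riemannZeta 3).re) - ∑ i ∈ Finset.range 1,
          ((harm (2 * i + 1) - harm i) / ((i : ℝ) + 1) ^ 2
            - 2 * (1 / (((i : ℝ) + 1) ^ 3 * (i + 1).centralBinom))) := by
    norm_num [harm, Nat.centralBinom]
    ring
  rw [hval]
  exact h

theorem mainTheorem4 :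
    (∀ n : ℕ+, Summable (fun k : ℕ+ => gammaTerm n k)) ∧
    HasSum (fun n : ℕ+ => ∑' k : ℕ+, gammaTerm n k)
      (47 / 12 * (riemannZeta 3).re - 4 * Real.pi / 3 * clausenTwo (Real.pi / 3)) ∧
    HasSum (fun p : ℕ+ × ℕ+ => gammaTerm p.1 p.2)
      (47 / 12 * (riemannZeta 3).re - 4 * Real.pi / 3 * clausenTwo (Real.pi / 3)) := by
  have h : HasSum (fun p : ℕ+ × ℕ+ => gammaTerm p.1 p.2)
      (47 / 12 * (riemannZeta 3).re - 4 * Real.pi / 3 * clausenTwo (Real.pi / 3)) := by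
    rw [← (Equiv.pnatEquivNat.symm.prodCongr Equiv.pnatEquivNat.symm).hasSum_iff]
    exact hasSum_gammaTerm_succPNat
  have hrow : ∀ n : ℕ+, Summable (fun k : ℕ+ => gammaTerm n k) := fun n =>
    h.summable.prod_factor n
  exact ⟨hrow, h.prod_fiberwise fun n => (hrow n).hasSum, h⟩
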